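/- Call a point $x\in\mathbb{R}^d$ computable if some Turing machine generates a sequence $(q_n)_{n\in\mathbb{N}}$ in $\mathbb{Q}^d$ with $\|x-q_n\|\le 2^{-n}$ for all $n$ (Euclidean norm). Call a non-empty closed set $A\subseteq\mathbb{R}^d$ co-r.e. if its distance function $d_A(x)=\inf\{\|x-a\|:a\in A\}$ is lower computable, i.e. if some (type-2) Turing machine, given any $x\in\mathbb{R}^d$ by any sequence $(q_n)$ in $\mathbb{Q}^d$ with $\|x-q_n\|\le 2^{-n}$ for all $n$, outputs a sequence $(p_m)$ of rational numbers with $d_A(x)=\sup_m p_m$ (equivalently, if the complement of $A$ is the union of a computably enumerable family of open balls with rational centers and radii). Call $A$ star-shaped if there is a point $s\in A$ such that for every $a\in A$ the segment $\{\lambda s+(1-\lambda)a:0\le\lambda\le 1\}$ is contained in $A$. **Theorem.** Every non-empty, co-r.e. closed, star-shaped set $A\subseteq\mathbb{R}^2$ contains a computable point. -/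

import Mathlib

/-- Codes of rational numbers: `(i, j, k)` stands for the rational `(i - j) / (k + 1)`.
Every rational has a code; machines read and write codes. -/
abbrev RatCode : Type := ℕ × ℕ × ℕ

/-- The rational number with a given code. -/
def RatCode.toRat (c : RatCode) : ℚ :=
  ((c.1 : ℚ) - (c.2.1 : ℚ)) / ((c.2.2 : ℚ) + 1)

/-- Every rational number has a code. -/
theorem RatCode.toRat_surjective : Function.Surjective RatCode.toRat := by
  intro q
  refine ⟨(q.num.toNat, (-q.num).toNat, q.den - 1), ?_⟩
  have h1 : ((q.den - 1 : ℕ) : ℚ) + 1 = q.den := by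
    have := q.pos
    exact_mod_cast Nat.sub_add_cancel this
  have h2 : ((q.num.toNat : ℚ) - ((-q.num).toNat : ℚ)) = q.num := by
    have : ((q.num.toNat : ℤ) - ((-q.num).toNat : ℤ)) = q.num := by omega
    exact_mod_cast this
  simp only [RatCode.toRat, h1, h2, Rat.num_div_den]

/-- The point of `ℚ^d ⊆ ℝ^d` whose coordinates are given by codes. -/
noncomputable def ratPoint {d : ℕ} (c : Fin d → RatCode) : EuclideanSpace ℝ (Fin d) :=
  WithLp.toLp 2 (fun i => ((c i).toRat : ℝ))

/-- The sequence `q` of (codes of) rational points converges fast to `x`. -/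
def IsFastName {d : ℕ} (q : ℕ → Fin d → RatCode) (x : EuclideanSpace ℝ (Fin d)) : Prop :=
  ∀ n : ℕ, ‖x - ratPoint (q n)‖ ≤ (2 : ℝ)⁻¹ ^ n

/-- A (Cauchy-)computable point of `ℝ^d`: some computable sequence of rational points
converges fast to it. -/
def IsComputablePoint {d : ℕ} (x : EuclideanSpace ℝ (Fin d)) : Prop :=
  ∃ q : ℕ → Fin d → RatCode, Computable q ∧ IsFastName q x

/-- Lower computability of `f : ℝ^d → ℝ`. A type-2 machine is given by the computable function
`h` that maps each finite initial segment of the input sequence to the finite part of the output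
sequence produced from it; longer inputs extend the output. On every fast converging sequence of
rational points with limit `x`, the machine has to produce an infinite sequence `p` of rationals
with `f x = sup_m p m`. -/
def LowerComputable {d : ℕ} (f : EuclideanSpace ℝ (Fin d) → ℝ) : Prop :=
  ∃ h : List (Fin d → RatCode) → List RatCode,
    Computable h ∧
    (∀ u v : List (Fin d → RatCode), u <+: v → h u <+: h v) ∧
    ∀ (x : EuclideanSpace ℝ (Fin d)) (q : ℕ → Fin d → RatCode), IsFastName q x →
      ∃ p : ℕ → RatCode,
        (∀ m : ℕ, ∃ n : ℕ, (h ((List.range n).map q))[m]? = some (p m)) ∧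
        IsLUB (Set.range fun m : ℕ => ((p m).toRat : ℝ)) (f x)

/-- A co-r.e. closed set: a closed set whose (Euclidean) distance function is lower computable.
(For the empty set, which is co-r.e., `Metric.infDist` is constantly `0`.) -/
def IsCoREClosed {d : ℕ} (A : Set (EuclideanSpace ℝ (Fin d))) : Prop :=
  IsClosed A ∧ LowerComputable (fun x => Metric.infDist x A)

/-- `A` is star-shaped: it contains a point `s` such that the segment from `s` to any point of `A`
lies in `A`. -/
def IsStarShaped {d : ℕ} (A : Set (EuclideanSpace ℝ (Fin d))) : Prop :=
  ∃ s ∈ A, ∀ a ∈ A, segment ℝ s a ⊆ A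

/-! ### Computability of bounded quantifiers and of searches -/

/-! If `A` contains a rational point, that point is computable. Otherwise let `s` be a centre of the
star. A segment in `A` whose line misses `s` would span with `s` a nondegenerate triangle inside
`A`, and its interior contains rational points. So the line of every nondegenerate segment in `A`
passes through `s` (`planeCross_eq_zero_of_segment_subset`).

If `A` is not contained in a line through `s`, this property determines `s`: two segments of `A`
ending at `s` in independent directions leave no other common point
(`isComputablePoint_of_not_collinear`). If `A` lies in a line, either `A = {s}` or some line
"coordinate = rational" meets `A` in exactly one point; an isolated solution of this kind is
computable (`isComputablePoint_of_unique_on_line`, `exists_isComputablePoint_of_collinear`).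

Both computations are one search, `isComputablePoint_of_search`. Since `A` is co-r.e., a pair of
grid points that is not close to a segment of `A` is eventually refuted. The machine looks for a
grid point that passes a decidable test against every pair not yet refuted. Compactness shows that
the search succeeds (`exists_limit_of_nearSegment`); genuine segments of `A`, which are never
refuted, force the grid point found to be near the target. The construction is not uniform: it uses
the case distinction and finitely many unknown constants. -/

theorem Primrec.nat_pow : Primrec₂ ((· ^ ·) : ℕ → ℕ → ℕ) :=
  Primrec₂.unpaired'.1 Nat.Primrec.pow

theorem Computable.forall_lt {α : Type*} [Primcodable α] {f : α → ℕ} {P : α → ℕ → Bool}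
    (hf : Computable f) (hP : Computable₂ P) :
    Computable fun a => decide (∀ i < f a, P a i = true) := by
  have h : Computable fun a => Nat.rec (motive := fun _ => Bool) true
      (fun i b => b && P a i) (f a) :=
    Computable.nat_rec hf (Computable.const true)
      (Primrec.and.to_comp.comp (Computable.snd.comp Computable.snd)
        (hP.comp Computable.fst (Computable.fst.comp Computable.snd))).to₂
  refine h.of_eq fun a => ?_
  induction f a with
  | zero => simp
  | succ k ih =>
    rw [Bool.eq_iff_iff] at ih ⊢
    simp only [Bool.and_eq_true, ih, decide_eq_true_eq, Nat.lt_succ_iff_lt_or_eq]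
    constructor
    · rintro ⟨h1, h2⟩ i (hi | rfl)
      · exact h1 i hi
      · exact h2
    · exact fun h => ⟨fun i hi => h i (Or.inl hi), h k (Or.inr rfl)⟩

theorem Computable.exists_lt {α : Type*} [Primcodable α] {f : α → ℕ} {P : α → ℕ → Bool}
    (hf : Computable f) (hP : Computable₂ P) :
    Computable fun a => decide (∃ i < f a, P a i = true) := by
  refine (Primrec.not.to_comp.comp
    (Computable.forall_lt (P := fun a i => !P a i) hf (Primrec.not.to_comp.comp hP))).of_eq
      fun a => ?_
  rw [Bool.eq_iff_iff]
  simp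

theorem Computable.exists_search {α : Type*} [Primcodable α] {W : α → ℕ → Bool}
    (hW : Computable₂ W) (hex : ∀ a, ∃ t, W a t = true) :
    ∃ f : α → ℕ, Computable f ∧ ∀ a, W a (f a) = true := by
  exact ⟨fun a => Nat.find (hex a),
    Computable.find (P := fun a t => W a t = true)
      (Computable.computablePred (hW.of_eq fun _ => by simp)) hex,
    fun a => Nat.find_spec (hex a)⟩

/-! ### Semi-decidable exclusion of rational points -/

theorem RatCode.two_div_lt_toRat_iff (c : RatCode) (n : ℕ) :
    2 / (2 : ℝ) ^ n < (c.toRat : ℝ) ↔ c.2.1 * 2 ^ n + 2 * (c.2.2 + 1) < c.1 * 2 ^ n := by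
  have h : (0 : ℝ) < (2 : ℝ) ^ n := by positivity
  have h' : (0 : ℝ) < (c.2.2 : ℝ) + 1 := by positivity
  simp only [RatCode.toRat]
  push_cast
  rw [div_lt_div_iff₀ h h', ← Nat.cast_lt (α := ℝ)]
  push_cast
  constructor <;> intro h <;> linarith

/-- A rational point has the constant sequence of its own code as a fast name. Stage `k` runs the
machine on `k` copies of the code and checks whether an output already exceeds the threshold. -/
theorem LowerComputable.exists_stage {d : ℕ} {f : EuclideanSpace ℝ (Fin d) → ℝ}
    (hf : LowerComputable f) :
    ∃ E : (Fin d → RatCode) × ℕ → ℕ → Bool, Computable₂ E ∧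
      ∀ c n, (∃ k, E (c, n) k = true) ↔ 2 / (2 : ℝ) ^ n < f (ratPoint c) := by
  classical
  obtain ⟨h, hcomp, hmono, hspec⟩ := hf
  let R : RatCode → ℕ → Prop := fun c n => c.2.1 * 2 ^ n + 2 * (c.2.2 + 1) < c.1 * 2 ^ n
  have hpow : Primrec₂ fun (_ : RatCode) (n : ℕ) => 2 ^ n :=
    Primrec.nat_pow.comp (Primrec.const 2) Primrec.snd
  have hc : Primrec₂ fun (c : RatCode) (_ : ℕ) => c := Primrec.fst
  have hR : PrimrecRel R := by
    refine Primrec.nat_lt.comp (Primrec.nat_add.comp (Primrec.nat_mul.comp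
      (Primrec.fst.comp (Primrec.snd.comp hc)) hpow) (Primrec.nat_mul.comp (Primrec.const 2)
      (Primrec.succ.comp (Primrec.snd.comp (Primrec.snd.comp hc))))) (Primrec.nat_mul.comp
      (Primrec.fst.comp hc) hpow)
  have hE := (PrimrecRel.exists_mem_list hR)
  have hE' := (primrecRel_iff_primrec_decide.1 hE).to_comp
  have hlist : Computable₂ fun (x : (Fin d → RatCode) × ℕ) (k : ℕ) =>
      (List.range k).map fun _ => x.1 :=
    Primrec₂.to_comp (Primrec.list_map (Primrec.list_range.comp Primrec.snd)
      (Primrec.fst.comp (Primrec.fst.comp Primrec.fst)).to₂).to₂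
  refine ⟨fun x k => decide (∃ p ∈ h ((List.range k).map fun _ => x.1), R p x.2),
    hE'.comp (hcomp.comp hlist) (Computable.snd.comp Computable.fst), fun c n => ?_⟩
  obtain ⟨p, hp, hlub⟩ := hspec (ratPoint c) (fun _ => c) (fun n => by simp)
  rw [lt_isLUB_iff hlub]
  simp only [decide_eq_true_eq, Set.mem_range, exists_exists_eq_and,
    RatCode.two_div_lt_toRat_iff]
  constructor
  · rintro ⟨k, x, hx, hRx⟩
    obtain ⟨m, hm⟩ := List.mem_iff_getElem?.1 hx
    obtain ⟨n', hn'⟩ := hp m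
    have hpre : ∀ u v : ℕ, u ≤ v → ∀ y, (h ((List.range u).map fun _ => c))[m]? = some y →
        (h ((List.range v).map fun _ => c))[m]? = some y := by
      intro u v huv y hy
      have h1 : (List.range u).map (fun _ => c) <+: (List.range v).map (fun _ => c) := by
        simpa using List.prefix_replicate_iff.2 (by simpa using huv)
      obtain ⟨t, ht⟩ := hmono _ _ h1
      rw [← ht, List.getElem?_append_left (List.getElem?_eq_some_iff.1 hy).1, hy]
    -- Longer inputs only extend the output, so an entry at position `m` is the same at every stage
    -- where it is present.
    have hxp : x = p m := by
      rcases le_total k n' with hk | hk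
      · exact Option.some.inj ((hpre _ _ hk _ hm).symm.trans hn')
      · exact Option.some.inj (hm.symm.trans (hpre _ _ hk _ hn'))
    exact ⟨m, hxp ▸ hRx⟩
  · rintro ⟨m, hm⟩
    obtain ⟨k, hk⟩ := hp m
    exact ⟨k, p m, List.mem_of_getElem? hk, hm⟩

/-! ### Grid points and their combinations -/

/-- The code of the convex combination of two grid points of level `n` with weights
`a / (a + b + 1)` and `(b + 1) / (a + b + 1)`; the grid has mesh `2⁻ⁿ` and origin `(-M, -M)`. -/
def combCode (M n a b : ℕ) (p r : Fin 2 → ℕ) : Fin 2 → RatCode :=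
  fun i => (a * p i + (b + 1) * r i, M * ((a + b + 1) * 2 ^ n), (a + b + 1) * 2 ^ n - 1)

/-- The grid point of level `n` with given indices. -/
noncomputable def gridPoint (M n : ℕ) (p : Fin 2 → ℕ) : EuclideanSpace ℝ (Fin 2) :=
  WithLp.toLp 2 fun i => (p i : ℝ) / 2 ^ n - M

theorem gridPoint_apply (M n : ℕ) (p : Fin 2 → ℕ) (i : Fin 2) :
    gridPoint M n p i = (p i : ℝ) / 2 ^ n - M := rfl

theorem ratPoint_combCode (M n a b : ℕ) (p r : Fin 2 → ℕ) :
    ratPoint (combCode M n a b p r) = ((a : ℝ) / (a + b + 1)) • gridPoint M n p +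
      (((b : ℝ) + 1) / (a + b + 1)) • gridPoint M n r := by
  -- The code stores the denominator minus one; the truncated subtraction is harmless because the
  -- denominator is positive.
  have h1 : ((((a + b + 1) * 2 ^ n - 1 : ℕ) : ℚ)) + 1 = (a + b + 1) * 2 ^ n := by
    have : 1 ≤ (a + b + 1) * 2 ^ n := Nat.one_le_iff_ne_zero.2 (by positivity)
    exact_mod_cast Nat.sub_add_cancel this
  have h2 : (a : ℝ) + b + 1 ≠ 0 := by positivity
  ext i
  simp only [ratPoint, combCode, RatCode.toRat, h1, PiLp.add_apply, PiLp.smul_apply,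
    gridPoint_apply, smul_eq_mul]
  push_cast
  field_simp
  ring

/-- The grid points `p`, `r` are such that every rational point between them is close to `A`. -/
def NearSegment (A : Set (EuclideanSpace ℝ (Fin 2))) (M n : ℕ) (p r : Fin 2 → ℕ) : Prop :=
  ∀ a b : ℕ, Metric.infDist (ratPoint (combCode M n a b p r)) A ≤ 2 / 2 ^ n

theorem Primrec.fin_two {α : Type*} [Primcodable α] {σ : Type*} [Primcodable σ]
    {f : α → Fin 2 → σ} (h : ∀ i, Primrec fun a => f a i) : Primrec f :=
  Primrec.fin_curry.2 ((Primrec.fin_curry₁ (f := fun i a => f a i)).2 h).swap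

theorem Primrec.fin_apply {α : Type*} [Primcodable α] {σ : Type*} [Primcodable σ] {n : ℕ}
    {f : α → Fin n → σ} (h : Primrec f) (i : Fin n) : Primrec fun a => f a i :=
  Primrec.fin_app.comp h (Primrec.const i)

theorem Primrec.combCode {α : Type*} [Primcodable α] (M : ℕ) {n a b : α → ℕ}
    {p r : α → Fin 2 → ℕ} (hn : Primrec n) (ha : Primrec a) (hb : Primrec b) (hp : Primrec p)
    (hr : Primrec r) : Primrec fun x => combCode M (n x) (a x) (b x) (p x) (r x) := by
  have hb' := Primrec.succ.comp hb
  have hw : Primrec fun x => (a x + b x + 1) * 2 ^ n x :=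
    Primrec.nat_mul.comp (Primrec.succ.comp (Primrec.nat_add.comp ha hb))
      (Primrec.nat_pow.comp (Primrec.const 2) hn)
  refine Primrec.fin_two fun i => Primrec.pair ?_ (Primrec.pair ?_ ?_)
  · exact Primrec.nat_add.comp (Primrec.nat_mul.comp ha (Primrec.fin_apply hp i))
      (Primrec.nat_mul.comp hb' (Primrec.fin_apply hr i))
  · exact Primrec.nat_mul.comp (Primrec.const M) hw
  · exact Primrec.nat_sub.comp hw (Primrec.const 1)

/-- Refuting `NearSegment` means finding weights and a machine stage that exhibit a point too far
from `A`. All three are packed into one number `j`, and the bound `j < k` makes the test monotone in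
`k`. -/
theorem exists_nearSegment_stage {A : Set (EuclideanSpace ℝ (Fin 2))}
    (hA : LowerComputable fun x => Metric.infDist x A) (M : ℕ) :
    ∃ K : ℕ × (Fin 2 → ℕ) × (Fin 2 → ℕ) → ℕ → Bool, Computable₂ K ∧
      (∀ x k l, k ≤ l → K x k = true → K x l = true) ∧
      ∀ n p r, (∃ k, K (n, p, r) k = true) ↔ ¬ NearSegment A M n p r := by
  obtain ⟨E, hE, hspec⟩ := hA.exists_stage
  let g : (ℕ × (Fin 2 → ℕ) × (Fin 2 → ℕ)) → ℕ → (Fin 2 → RatCode) × ℕ := fun x j =>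
    (combCode M x.1 j.unpair.1 j.unpair.2.unpair.1 x.2.1 x.2.2, x.1)
  have hu : Primrec fun y : (ℕ × (Fin 2 → ℕ) × (Fin 2 → ℕ)) × ℕ => y.2.unpair :=
    Primrec.unpair.comp Primrec.snd
  have hu2 := Primrec.unpair.comp (Primrec.snd.comp hu)
  have hx : Primrec fun y : (ℕ × (Fin 2 → ℕ) × (Fin 2 → ℕ)) × ℕ => y.1 := Primrec.fst
  have hg : Primrec fun y : (ℕ × (Fin 2 → ℕ) × (Fin 2 → ℕ)) × ℕ => g y.1 y.2 :=
    Primrec.pair (Primrec.combCode M (Primrec.fst.comp hx) (Primrec.fst.comp hu)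
      (Primrec.fst.comp hu2) (Primrec.fst.comp (Primrec.snd.comp hx))
      (Primrec.snd.comp (Primrec.snd.comp hx))) (Primrec.fst.comp hx)
  have hP : Computable₂ fun (y : (ℕ × (Fin 2 → ℕ) × (Fin 2 → ℕ)) × ℕ) (j : ℕ) =>
      E (g y.1 j) j.unpair.2.unpair.2 := by
    have h1 : Primrec fun y : ((ℕ × (Fin 2 → ℕ) × (Fin 2 → ℕ)) × ℕ) × ℕ => (y.1.1, y.2) :=
      Primrec.pair (Primrec.fst.comp Primrec.fst) Primrec.snd
    exact hE.comp (hg.comp h1).to_comp ((Primrec.snd.comp hu2).comp h1).to_comp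
  refine ⟨fun x k => decide (∃ j < k, E (g x j) j.unpair.2.unpair.2 = true),
    Computable.exists_lt Computable.snd hP, ?_, ?_⟩
  · intro x k l hkl
    simp only [decide_eq_true_eq]
    rintro ⟨j, hj, h⟩
    exact ⟨j, hj.trans_le hkl, h⟩
  · intro n p r
    simp only [decide_eq_true_eq, NearSegment, not_forall, not_le, ← hspec]
    constructor
    · rintro ⟨k, j, -, h⟩
      exact ⟨_, _, _, h⟩
    · rintro ⟨a, b, k, h⟩
      exact ⟨_, Nat.pair a (Nat.pair b k), Nat.lt_succ_self _, by simpa [g] using h⟩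

/-! ### Computing a point by testing grid candidates -/

/-- The number of grid indices of level `n` per coordinate. -/
def gridSize (M n : ℕ) : ℕ := 2 * M * 2 ^ n + 1

/-- The pair of the two lowest digits of `t` in base `B`. -/
def lowDigits (B t : ℕ) : Fin 2 → ℕ := ![t % B, t / B % B]

theorem lowDigits_lt {B : ℕ} (hB : 0 < B) (t : ℕ) (i : Fin 2) : lowDigits B t i < B := by
  fin_cases i <;> exact Nat.mod_lt _ hB

theorem lowDigits_add_mul {B : ℕ} {p : Fin 2 → ℕ} (hp : ∀ i, p i < B) (t : ℕ) :
    lowDigits B (p 0 + B * (p 1 + B * t)) = p := by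
  have hB : 0 < B := (Nat.zero_le _).trans_lt (hp 0)
  ext i
  fin_cases i
  · simp [lowDigits, Nat.mod_eq_of_lt (hp 0)]
  · simp [lowDigits, Nat.add_mul_div_left _ _ hB, Nat.div_eq_of_lt (hp 0),
      Nat.mod_eq_of_lt (hp 1)]

theorem Primrec.lowDigits {α : Type*} [Primcodable α] {B t : α → ℕ} (hB : Primrec B)
    (ht : Primrec t) : Primrec fun x => lowDigits (B x) (t x) := by
  refine Primrec.fin_two fun i => ?_
  fin_cases i
  · exact Primrec.nat_mod.comp ht hB
  · exact Primrec.nat_mod.comp (Primrec.nat_div.comp ht hB) hB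

/-- Four base-`B` digits code a pair of grid points, so quantifying over all pairs is a bounded
quantifier over one number. -/
theorem exists_lowDigits_eq {B : ℕ} {p r : Fin 2 → ℕ} (hp : ∀ i, p i < B) (hr : ∀ i, r i < B) :
    ∃ t < B ^ 4, lowDigits B t = p ∧ lowDigits B (t / B ^ 2) = r := by
  have hB : 0 < B := (Nat.zero_le _).trans_lt (hp 0)
  have key : ∀ {x y C D : ℕ}, x < C → y < D → x + C * y < C * D := by
    intro x y C D hx hy
    calc x + C * y < C + C * y := by omega
      _ = C * (y + 1) := by ring
      _ ≤ C * D := Nat.mul_le_mul_left _ hy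
  refine ⟨p 0 + B * (p 1 + B * (r 0 + B * (r 1 + B * 0))), ?_, lowDigits_add_mul hp _, ?_⟩
  · have h := key (hp 0) (key (hp 1) (key (hr 0) (hr 1)))
    calc _ = p 0 + B * (p 1 + B * (r 0 + B * r 1)) := by ring
      _ < _ := h
      _ = _ := by ring
  · have h : (p 0 + B * (p 1 + B * (r 0 + B * (r 1 + B * 0)))) / B ^ 2 =
        r 0 + B * (r 1 + B * 0) := by
      rw [pow_two, ← Nat.div_div_eq_div_mul, Nat.add_mul_div_left _ _ hB,
        Nat.div_eq_of_lt (hp 0), zero_add, Nat.add_mul_div_left _ _ hB,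
        Nat.div_eq_of_lt (hp 1), zero_add]
    rw [h, lowDigits_add_mul hr]

/-- Instances of the test that a candidate `s` passes to precision `m` at level `n` on the
pair `p`, `r`: tuples `(m, n, s, p, r)`. -/
abbrev TestInstance : Type := ℕ × ℕ × (Fin 2 → ℕ) × (Fin 2 → ℕ) × (Fin 2 → ℕ)

/-- `hcomplete` makes the search for a candidate terminate at each precision `m`; `hsound` makes
every candidate it can return accurate. Only finitely many pairs occur at a level, so one stage
suffices to refute all those that need it. -/
theorem isComputablePoint_of_search {A : Set (EuclideanSpace ℝ (Fin 2))}
    (hA : LowerComputable fun x => Metric.infDist x A) (M : ℕ) {Good : TestInstance → Prop}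
    (hGood : PrimrecPred Good) {z : EuclideanSpace ℝ (Fin 2)} (C : ℝ)
    (hcomplete : ∀ m, ∃ n ≥ m, ∃ s : Fin 2 → ℕ, (∀ i, s i < gridSize M n) ∧
      ∀ p r : Fin 2 → ℕ, (∀ i, p i < gridSize M n) → (∀ i, r i < gridSize M n) →
        NearSegment A M n p r → Good (m, n, s, p, r))
    (hsound : ∀ m n, m ≤ n → ∀ s : Fin 2 → ℕ, (∀ i, s i < gridSize M n) →
      (∀ p r : Fin 2 → ℕ, (∀ i, p i < gridSize M n) → (∀ i, r i < gridSize M n) →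
        NearSegment A M n p r → Good (m, n, s, p, r)) →
      ‖z - gridPoint M n s‖ ≤ C / 2 ^ m) :
    IsComputablePoint z := by
  obtain ⟨_, hG⟩ := hGood
  obtain ⟨K, hK, hKmono, hKspec⟩ := exists_nearSegment_stage hA M
  let lev : ℕ → ℕ → ℕ := fun m t => m + t.unpair.1
  let cand : ℕ → ℕ → Fin 2 → ℕ := fun m t => lowDigits (gridSize M (lev m t)) t.unpair.2.unpair.1
  let fst : ℕ → ℕ → ℕ → Fin 2 → ℕ := fun m t i => lowDigits (gridSize M (lev m t)) i
  let sec : ℕ → ℕ → ℕ → Fin 2 → ℕ := fun m t i =>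
    lowDigits (gridSize M (lev m t)) (i / gridSize M (lev m t) ^ 2)
  -- `t` codes the excess of the level over `m`, the candidate and the stage.
  let W : ℕ → ℕ → Bool := fun m t => decide (∀ i < gridSize M (lev m t) ^ 4,
    (K (lev m t, fst m t i, sec m t i) t.unpair.2.unpair.2 ||
      decide (Good (m, lev m t, cand m t, fst m t i, sec m t i))) = true)
  have hlev : Primrec₂ lev := Primrec.nat_add.comp Primrec.fst
    (Primrec.fst.comp (Primrec.unpair.comp Primrec.snd))
  have hsize : Primrec₂ fun m t => gridSize M (lev m t) :=
    Primrec.succ.comp (Primrec.nat_mul.comp (Primrec.const (2 * M))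
      (Primrec.nat_pow.comp (Primrec.const 2) hlev))
  have hpair : Primrec₂ fun (_ t : ℕ) => t.unpair.2.unpair :=
    Primrec.unpair.comp (Primrec.snd.comp (Primrec.unpair.comp Primrec.snd))
  have hcand : Primrec₂ cand := Primrec.lowDigits hsize (Primrec.fst.comp hpair)
  have hW : Computable₂ W := by
    have hsize' : Primrec fun y : (ℕ × ℕ) × ℕ => gridSize M (lev y.1.1 y.1.2) :=
      hsize.comp (Primrec.fst.comp Primrec.fst) (Primrec.snd.comp Primrec.fst)
    have hlev' : Primrec fun y : (ℕ × ℕ) × ℕ => lev y.1.1 y.1.2 :=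
      hlev.comp (Primrec.fst.comp Primrec.fst) (Primrec.snd.comp Primrec.fst)
    have hcand' : Primrec fun y : (ℕ × ℕ) × ℕ => cand y.1.1 y.1.2 :=
      hcand.comp (Primrec.fst.comp Primrec.fst) (Primrec.snd.comp Primrec.fst)
    have hk' : Primrec fun y : (ℕ × ℕ) × ℕ => y.1.2.unpair.2.unpair.2 :=
      Primrec.snd.comp (hpair.comp (Primrec.fst.comp Primrec.fst) (Primrec.snd.comp Primrec.fst))
    have hfst : Primrec fun y : (ℕ × ℕ) × ℕ => fst y.1.1 y.1.2 y.2 :=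
      Primrec.lowDigits hsize' Primrec.snd
    have hsec : Primrec fun y : (ℕ × ℕ) × ℕ => sec y.1.1 y.1.2 y.2 :=
      Primrec.lowDigits hsize' (Primrec.nat_div.comp Primrec.snd
        (Primrec.nat_pow.comp hsize' (Primrec.const 2)))
    refine Computable.forall_lt (α := ℕ × ℕ) (f := fun y => gridSize M (lev y.1 y.2) ^ 4)
      (P := fun y i => K (lev y.1 y.2, fst y.1 y.2 i, sec y.1 y.2 i) y.2.unpair.2.unpair.2 ||
        decide (Good (y.1, lev y.1 y.2, cand y.1 y.2, fst y.1 y.2 i, sec y.1 y.2 i)))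
      (Primrec.nat_pow.comp hsize (Primrec.const 4)).to_comp
      (Primrec.or.to_comp.comp (hK.comp (hlev'.pair (hfst.pair hsec)).to_comp hk'.to_comp) ?_)
    exact (hG.comp ((Primrec.fst.comp Primrec.fst).pair
      (hlev'.pair (hcand'.pair (hfst.pair hsec))))).to_comp
  have hpos : ∀ n, 0 < gridSize M n := fun n => Nat.succ_pos _
  have hex : ∀ m, ∃ t, W m t = true := by
    intro m
    obtain ⟨n, hn, s, hs, hall⟩ := hcomplete m
    have hstage : ∀ i, ∃ k, K (n, lowDigits (gridSize M n) i,
        lowDigits (gridSize M n) (i / gridSize M n ^ 2)) k = true ∨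
        Good (m, n, s, lowDigits (gridSize M n) i,
          lowDigits (gridSize M n) (i / gridSize M n ^ 2)) := by
      intro i
      by_cases hi : NearSegment A M n (lowDigits (gridSize M n) i)
          (lowDigits (gridSize M n) (i / gridSize M n ^ 2))
      · exact ⟨0, Or.inr (hall _ _ (lowDigits_lt (hpos n) _) (lowDigits_lt (hpos n) _) hi)⟩
      · obtain ⟨k, hk⟩ := (hKspec _ _ _).2 hi
        exact ⟨k, Or.inl hk⟩
    choose k hk using hstage
    let t := Nat.pair (n - m) (Nat.pair (s 0 + gridSize M n * (s 1 + gridSize M n * 0))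
      ((Finset.range (gridSize M n ^ 4)).sup k))
    have ht : lev m t = n := by simp [lev, t]; omega
    have hc : cand m t = s := by
      simp only [cand, ht]
      simp only [t, Nat.unpair_pair]
      exact lowDigits_add_mul hs 0
    refine ⟨t, ?_⟩
    simp only [W, fst, sec, hc, ht, decide_eq_true_eq, Bool.or_eq_true]
    intro i hi
    refine (hk i).imp (fun h => hKmono _ _ _ ?_ h) id
    simp only [t, Nat.unpair_pair]
    exact Finset.le_sup (f := k) (Finset.mem_range.2 hi)
  obtain ⟨f, hf, hfW⟩ := Computable.exists_search hW hex
  have hdist : ∀ m, ‖z - gridPoint M (lev m (f m)) (cand m (f m))‖ ≤ C / 2 ^ m := by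
    intro m
    refine hsound m _ (Nat.le_add_right _ _) _ (lowDigits_lt (hpos _) _) fun p r hp hr h => ?_
    obtain ⟨i, hi, hip, hir⟩ := exists_lowDigits_eq hp hr
    have h1 := hfW m
    simp only [W, decide_eq_true_eq, Bool.or_eq_true] at h1
    have h2 := h1 i hi
    rw [show fst m (f m) i = p from hip, show sec m (f m) i = r from hir] at h2
    exact h2.resolve_left fun h3 => (hKspec _ _ _).1 ⟨_, h3⟩ h
  -- Running the search `c` steps ahead in precision absorbs the factor `C`.
  obtain ⟨c, hc⟩ := pow_unbounded_of_one_lt C (one_lt_two (α := ℝ))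
  let code : ℕ → Fin 2 → RatCode := fun m =>
    combCode M (lev m (f m)) 0 0 (cand m (f m)) (cand m (f m))
  have hcode : Computable code := by
    have h : Primrec₂ fun m t => combCode M (lev m t) 0 0 (cand m t) (cand m t) :=
      Primrec.combCode M hlev (Primrec.const 0) (Primrec.const 0) hcand hcand
    exact h.to_comp.comp Computable.id hf
  refine ⟨fun m => code (m + c),
    hcode.comp (Primrec.nat_add.comp Primrec.id (Primrec.const c)).to_comp, fun m => ?_⟩
  have h1 : ratPoint (code (m + c)) =
      gridPoint M (lev (m + c) (f (m + c))) (cand (m + c) (f (m + c))) := by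
    simp [code, ratPoint_combCode]
  rw [h1]
  refine (hdist _).trans ?_
  rw [div_le_iff₀ (by positivity), pow_add, ← mul_assoc, ← mul_pow]
  simpa using hc.le

open Filter Topology

/-! ### Grid approximation in the plane -/

theorem EuclideanSpace.norm_le_two_mul {x : EuclideanSpace ℝ (Fin 2)} {a : ℝ}
    (h : ∀ i, |x i| ≤ a) : ‖x‖ ≤ 2 * a := by
  have ha : 0 ≤ a := (abs_nonneg _).trans (h 0)
  rw [EuclideanSpace.norm_eq, Real.sqrt_le_left (by positivity), Fin.sum_univ_two]
  have h0 := pow_le_pow_left₀ (abs_nonneg _) (h 0) 2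
  have h1 := pow_le_pow_left₀ (abs_nonneg _) (h 1) 2
  simp only [Real.norm_eq_abs]
  nlinarith [sq_nonneg a]

theorem EuclideanSpace.abs_apply_le_norm (x : EuclideanSpace ℝ (Fin 2)) (i : Fin 2) :
    |x i| ≤ ‖x‖ := PiLp.norm_apply_le x i

theorem exists_nat_abs_le (x y z : EuclideanSpace ℝ (Fin 2)) :
    ∃ M : ℕ, ∀ i, |x i| ≤ M ∧ |y i| ≤ M ∧ |z i| ≤ M := by
  obtain ⟨M, hM⟩ := exists_nat_ge (max ‖x‖ (max ‖y‖ ‖z‖))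
  simp only [max_le_iff] at hM
  exact ⟨M, fun i => ⟨(EuclideanSpace.abs_apply_le_norm x i).trans hM.1,
    (EuclideanSpace.abs_apply_le_norm y i).trans hM.2.1,
    (EuclideanSpace.abs_apply_le_norm z i).trans hM.2.2⟩⟩

theorem exists_gridPoint_near {x : EuclideanSpace ℝ (Fin 2)} {M : ℕ} (hx : ∀ i, |x i| ≤ M)
    (n : ℕ) : ∃ p : Fin 2 → ℕ, (∀ i, p i < gridSize M n) ∧
      ∀ i, |x i - gridPoint M n p i| ≤ 1 / 2 ^ n := by
  have h2 : (0 : ℝ) < 2 ^ n := by positivity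
  refine ⟨fun i => ⌊(x i + M) * 2 ^ n⌋₊, fun i => ?_, fun i => ?_⟩
  · have h := abs_le.1 (hx i)
    refine Nat.lt_succ_of_le (Nat.floor_le_of_le ?_)
    push_cast
    nlinarith
  · have h := abs_le.1 (hx i)
    have h0 : 0 ≤ (x i + M) * 2 ^ n := mul_nonneg (by linarith) h2.le
    have h3 := Nat.floor_le h0
    have h4 := Nat.lt_floor_add_one ((x i + M) * 2 ^ n)
    have h5 : x i - gridPoint M n (fun i => ⌊(x i + M) * 2 ^ n⌋₊) i =
        ((x i + M) * 2 ^ n - ⌊(x i + M) * 2 ^ n⌋₊) / 2 ^ n := by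
      rw [gridPoint_apply]
      field_simp
      ring
    rw [h5, abs_of_nonneg (div_nonneg (by linarith) h2.le)]
    exact div_le_div_of_nonneg_right (by linarith) h2.le

theorem abs_gridPoint_le {M n : ℕ} {p : Fin 2 → ℕ} (hp : ∀ i, p i < gridSize M n) (i : Fin 2) :
    |gridPoint M n p i| ≤ M := by
  have h : (p i : ℝ) ≤ 2 * M * 2 ^ n := by exact_mod_cast Nat.lt_succ_iff.1 (hp i)
  have h2 : (p i : ℝ) / 2 ^ n ≤ 2 * M := by rwa [div_le_iff₀ (by positivity)]
  have h3 : 0 ≤ (p i : ℝ) / 2 ^ n := by positivity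
  rw [gridPoint_apply, abs_le]
  constructor <;> linarith

theorem tendsto_one_div_two_pow_add (m : ℕ) {φ : ℕ → ℕ} (hφ : StrictMono φ) (c : ℝ) :
    Tendsto (fun k => c / (2 : ℝ) ^ (m + φ k)) atTop (𝓝 0) := by
  have h : Tendsto (fun n : ℕ => c * (1 / 2 : ℝ) ^ n) atTop (𝓝 (c * 0)) :=
    (tendsto_pow_atTop_nhds_zero_of_lt_one (by norm_num) (by norm_num)).const_mul c
  rw [mul_zero] at h
  refine (h.comp (tendsto_atTop_mono (fun k => Nat.le_add_left (φ k) m) hφ.tendsto_atTop)).congr fun k => ?_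
  simp [div_eq_mul_inv]

theorem exists_ratPoint_mem {U : Set (EuclideanSpace ℝ (Fin 2))} (hU : IsOpen U)
    (hne : U.Nonempty) : ∃ c, ratPoint c ∈ U := by
  obtain ⟨x, hx⟩ := hne
  obtain ⟨ε, hε, hball⟩ := Metric.isOpen_iff.1 hU x hx
  obtain ⟨M, hM⟩ := exists_nat_abs_le x x x
  obtain ⟨n, hn⟩ := ((tendsto_one_div_two_pow_add 0 strictMono_id 2).eventually_lt_const hε).exists
  obtain ⟨p, -, hp⟩ := exists_gridPoint_near (fun i => (hM i).1) (0 + id n)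
  refine ⟨combCode M (0 + id n) 0 0 p p, hball ?_⟩
  have h1 : ‖x - gridPoint M (0 + id n) p‖ ≤ 2 * (1 / 2 ^ (0 + id n)) :=
    EuclideanSpace.norm_le_two_mul hp
  rw [Metric.mem_ball, dist_comm, dist_eq_norm]
  simp only [ratPoint_combCode, Nat.cast_zero, zero_add, zero_smul, div_one, one_smul]
    at h1 hn ⊢
  refine h1.trans_lt (lt_of_eq_of_lt ?_ hn)
  ring

/-- This explains the tolerance `2 / 2 ^ n`: rounding moves each coordinate by at most `1 / 2 ^ n`,
hence each endpoint by at most twice that, and convex combinations do not increase the error. -/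
theorem nearSegment_of_segment_subset {A : Set (EuclideanSpace ℝ (Fin 2))} {M n : ℕ}
    {x y : EuclideanSpace ℝ (Fin 2)} (hxy : segment ℝ x y ⊆ A) {p r : Fin 2 → ℕ}
    (hp : ∀ i, |x i - gridPoint M n p i| ≤ 1 / 2 ^ n)
    (hr : ∀ i, |y i - gridPoint M n r i| ≤ 1 / 2 ^ n) : NearSegment A M n p r := by
  intro a b
  rw [ratPoint_combCode]
  set u : ℝ := (a : ℝ) / (a + b + 1)
  set v : ℝ := ((b : ℝ) + 1) / (a + b + 1)
  have hu : 0 ≤ u := by positivity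
  have hv : 0 ≤ v := by positivity
  have huv : u + v = 1 := by
    simp only [u, v]
    field_simp
    ring
  have hmem : u • x + v • y ∈ A := hxy ⟨u, v, hu, hv, huv, rfl⟩
  refine (Metric.infDist_le_dist_of_mem hmem).trans ?_
  have h1 : ‖x - gridPoint M n p‖ ≤ 2 * (1 / 2 ^ n) := EuclideanSpace.norm_le_two_mul hp
  have h2 : ‖y - gridPoint M n r‖ ≤ 2 * (1 / 2 ^ n) := EuclideanSpace.norm_le_two_mul hr
  rw [dist_comm, dist_eq_norm]
  have h3 : u • x + v • y - (u • gridPoint M n p + v • gridPoint M n r) =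
      u • (x - gridPoint M n p) + v • (y - gridPoint M n r) := by
    simp only [smul_sub]
    abel
  rw [h3]
  calc _ ≤ ‖u • (x - gridPoint M n p)‖ + ‖v • (y - gridPoint M n r)‖ := norm_add_le _ _
    _ = u * ‖x - gridPoint M n p‖ + v * ‖y - gridPoint M n r‖ := by
      rw [norm_smul, norm_smul, Real.norm_of_nonneg hu, Real.norm_of_nonneg hv]
    _ ≤ u * (2 * (1 / 2 ^ n)) + v * (2 * (1 / 2 ^ n)) := by gcongr
    _ = 2 / 2 ^ n := by rw [← add_mul, huv]; ring

theorem segment_subset_of_rat_weights {A : Set (EuclideanSpace ℝ (Fin 2))} (hA : IsClosed A)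
    {x y : EuclideanSpace ℝ (Fin 2)}
    (h : ∀ a b : ℕ, ((a : ℝ) / (a + b + 1)) • x + (((b : ℝ) + 1) / (a + b + 1)) • y ∈ A) :
    segment ℝ x y ⊆ A := by
  rw [segment_eq_image]
  rintro _ ⟨t, ⟨ht0, ht1⟩, rfl⟩
  have hlim : Tendsto (fun k : ℕ => ((⌊t * k⌋₊ : ℝ) + 1) / (k + 1)) atTop (𝓝 t) := by
    rw [tendsto_iff_norm_sub_tendsto_zero]
    refine squeeze_zero (fun _ => norm_nonneg _) (fun k => ?_)
      (tendsto_one_div_add_atTop_nhds_zero_nat (𝕜 := ℝ))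
    have h1 := Nat.floor_le (mul_nonneg ht0 (Nat.cast_nonneg (α := ℝ) k))
    have h2 := Nat.lt_floor_add_one (t * k)
    have hk : (0 : ℝ) < (k : ℝ) + 1 := by positivity
    have h3 : ((⌊t * k⌋₊ : ℝ) + 1) / (k + 1) - t = ((⌊t * k⌋₊ : ℝ) + 1 - t * k - t) / (k + 1) := by
      field_simp
      ring
    rw [h3, Real.norm_eq_abs, abs_div, abs_of_pos hk]
    refine div_le_div_of_nonneg_right (abs_le.2 ⟨?_, ?_⟩) hk.le <;> linarith
  have hcont : Continuous fun t : ℝ => (1 - t) • x + t • y := by fun_prop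
  refine hA.mem_of_tendsto ((hcont.tendsto t).comp hlim) (Eventually.of_forall fun k => ?_)
  have hfl : ⌊t * k⌋₊ ≤ k := Nat.floor_le_of_le (by nlinarith [Nat.cast_nonneg (α := ℝ) k])
  -- These weights have sum `k + 1` in the denominator and give `y` the weight `(⌊t * k⌋₊ + 1) / (k
  -- + 1)`.
  have h1 := h (k - ⌊t * k⌋₊) ⌊t * k⌋₊
  rw [Nat.cast_sub hfl, sub_add_cancel] at h1
  simp only [Function.comp]
  convert h1 using 3
  field_simp
  ring

/-- All grid points lie in a fixed ball, so a subsequence of the pairs converges. For fixed rational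
weights the distance to `A` tends to zero, and closedness gives the whole limit segment. -/
theorem exists_limit_of_nearSegment {A : Set (EuclideanSpace ℝ (Fin 2))} (hA : IsClosed A)
    (hne : A.Nonempty) {M m : ℕ} {p r : ℕ → Fin 2 → ℕ}
    (hp : ∀ k i, p k i < gridSize M (m + k)) (hr : ∀ k i, r k i < gridSize M (m + k))
    (hpr : ∀ k, NearSegment A M (m + k) (p k) (r k)) :
    ∃ x y, ∃ φ : ℕ → ℕ, StrictMono φ ∧ segment ℝ x y ⊆ A ∧
      Tendsto (fun k => gridPoint M (m + φ k) (p (φ k))) atTop (𝓝 x) ∧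
      Tendsto (fun k => gridPoint M (m + φ k) (r (φ k))) atTop (𝓝 y) := by
  have hball : ∀ {n : ℕ} {q : Fin 2 → ℕ}, (∀ i, q i < gridSize M n) →
      gridPoint M n q ∈ Metric.closedBall (0 : EuclideanSpace ℝ (Fin 2)) (2 * M) := fun hq =>
    mem_closedBall_zero_iff.2 (EuclideanSpace.norm_le_two_mul (abs_gridPoint_le hq))
  have hcpt := (isCompact_closedBall (0 : EuclideanSpace ℝ (Fin 2)) (2 * M)).prod
    (isCompact_closedBall (0 : EuclideanSpace ℝ (Fin 2)) (2 * M))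
  obtain ⟨⟨x, y⟩, -, φ, hφ, hlim⟩ := hcpt.tendsto_subseq
    (x := fun k => (gridPoint M (m + k) (p k), gridPoint M (m + k) (r k)))
    fun k => ⟨hball (hp k), hball (hr k)⟩
  have hx := (continuous_fst.tendsto _).comp hlim
  have hy := (continuous_snd.tendsto _).comp hlim
  refine ⟨x, y, φ, hφ, segment_subset_of_rat_weights hA fun a b => ?_, hx, hy⟩
  have h1 := ((Metric.continuous_infDist_pt A).tendsto _).comp
    ((hx.const_smul ((a : ℝ) / (a + b + 1))).add (hy.const_smul (((b : ℝ) + 1) / (a + b + 1))))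
  have h2 := le_of_tendsto_of_tendsto h1 (tendsto_one_div_two_pow_add m hφ 2)
    (Eventually.of_forall fun k => by
      have h3 := hpr (φ k) a b
      rw [ratPoint_combCode] at h3
      exact h3)
  rw [hA.mem_iff_infDist_zero hne]
  exact le_antisymm h2 Metric.infDist_nonneg

/-! ### Segments in a star-shaped set without rational points -/

/-- The cross product of two vectors of the plane. -/
def planeCross (u v : EuclideanSpace ℝ (Fin 2)) : ℝ := u 0 * v 1 - u 1 * v 0

theorem continuous_planeCross :
    Continuous fun w : EuclideanSpace ℝ (Fin 2) × EuclideanSpace ℝ (Fin 2) =>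
      planeCross w.1 w.2 := by
  unfold planeCross
  fun_prop

theorem planeCross_eq_zero_of_segment_subset {A : Set (EuclideanSpace ℝ (Fin 2))}
    {s : EuclideanSpace ℝ (Fin 2)} (hs : ∀ a ∈ A, segment ℝ s a ⊆ A)
    (hrat : ∀ c, ratPoint c ∉ A) {p r : EuclideanSpace ℝ (Fin 2)} (hpr : segment ℝ p r ⊆ A) :
    planeCross (p - s) (r - s) = 0 := by
  by_contra hD
  set D := planeCross (p - s) (r - s) with hDdef
  -- By Cramer's rule `α`, `β` are the affine coordinates with origin `s` and basis `p - s`, `r -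
  -- s`; `U` is the open triangle.
  let α : EuclideanSpace ℝ (Fin 2) → ℝ := fun y => planeCross (y - s) (r - s) / D
  let β : EuclideanSpace ℝ (Fin 2) → ℝ := fun y => planeCross (p - s) (y - s) / D
  have hα : Continuous α := by simp only [α, planeCross]; fun_prop
  have hβ : Continuous β := by simp only [β, planeCross]; fun_prop
  let U : Set (EuclideanSpace ℝ (Fin 2)) := {y | 0 < α y} ∩ {y | 0 < β y} ∩ {y | α y + β y < 1}
  have hU : IsOpen U := ((isOpen_lt continuous_const hα).inter
    (isOpen_lt continuous_const hβ)).inter (isOpen_lt (hα.add hβ) continuous_const)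
  have hne : U.Nonempty := by
    refine ⟨s + (1 / 4 : ℝ) • (p - s) + (1 / 4 : ℝ) • (r - s), ?_⟩
    have h1 : α (s + (1 / 4 : ℝ) • (p - s) + (1 / 4 : ℝ) • (r - s)) = 1 / 4 := by
      simp only [α]
      rw [div_eq_iff hD, hDdef]
      simp only [planeCross, PiLp.add_apply, PiLp.sub_apply, PiLp.smul_apply, smul_eq_mul]
      ring
    have h2 : β (s + (1 / 4 : ℝ) • (p - s) + (1 / 4 : ℝ) • (r - s)) = 1 / 4 := by
      simp only [β]
      rw [div_eq_iff hD, hDdef]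
      simp only [planeCross, PiLp.add_apply, PiLp.sub_apply, PiLp.smul_apply, smul_eq_mul]
      ring
    simp only [U, Set.mem_inter_iff, Set.mem_ofPred_eq, h1, h2]
    norm_num
  obtain ⟨c, hc⟩ := exists_ratPoint_mem hU hne
  obtain ⟨⟨h1, h2⟩, h3⟩ := hc
  simp only [Set.mem_ofPred_eq] at h1 h2 h3
  set y := ratPoint c with hy
  refine hrat c ?_
  rw [← hy]
  have hab : 0 < α y + β y := by linarith
  -- The ray from `s` through `y` meets the segment from `p` to `r` here, and `y` lies before that
  -- point.
  have hq : (α y / (α y + β y)) • p + (β y / (α y + β y)) • r ∈ A :=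
    hpr ⟨_, _, by positivity, by positivity, by field_simp, rfl⟩
  refine hs _ hq ⟨1 - (α y + β y), α y + β y, by linarith, hab.le, by ring, ?_⟩
  rw [smul_add, smul_smul, smul_smul, mul_div_cancel₀ _ hab.ne', mul_div_cancel₀ _ hab.ne']
  have hcoord : ∀ i, α y * (p i - s i) + β y * (r i - s i) = y i - s i := by
    intro i
    simp only [α, β]
    field_simp
    rw [hDdef]
    fin_cases i <;> simp [planeCross] <;> ring
  ext i
  have := hcoord i
  simp only [PiLp.add_apply, PiLp.smul_apply, smul_eq_mul]
  linarith

/-! ### The centre of a star that is not contained in a line -/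

/-- The segment between the grid points `p` and `r` almost points to the candidate `s`:
`|planeCross (p - s) (r - s)| ≤ 2⁻ᵐ`, expressed with natural numbers. -/
def PointsToCandidate (x : TestInstance) : Prop :=
  (x.2.2.2.1 0 * x.2.2.2.2 1 + x.2.2.2.1 1 * x.2.2.1 0 + x.2.2.1 1 * x.2.2.2.2 0) * 2 ^ x.1 ≤
      (x.2.2.2.1 0 * x.2.2.1 1 + x.2.2.1 0 * x.2.2.2.2 1 + x.2.2.2.1 1 * x.2.2.2.2 0) * 2 ^ x.1 +
        2 ^ x.2.1 * 2 ^ x.2.1 ∧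
    (x.2.2.2.1 0 * x.2.2.1 1 + x.2.2.1 0 * x.2.2.2.2 1 + x.2.2.2.1 1 * x.2.2.2.2 0) * 2 ^ x.1 ≤
      (x.2.2.2.1 0 * x.2.2.2.2 1 + x.2.2.2.1 1 * x.2.2.1 0 + x.2.2.1 1 * x.2.2.2.2 0) * 2 ^ x.1 +
        2 ^ x.2.1 * 2 ^ x.2.1

namespace TestInstance

theorem primrec_pow_precision : Primrec fun x : TestInstance => 2 ^ x.1 :=
  Primrec.nat_pow.comp (Primrec.const 2) Primrec.fst

theorem primrec_pow_level : Primrec fun x : TestInstance => 2 ^ x.2.1 :=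
  Primrec.nat_pow.comp (Primrec.const 2) (Primrec.fst.comp Primrec.snd)

theorem primrec_candidate (i : Fin 2) : Primrec fun x : TestInstance => x.2.2.1 i :=
  Primrec.fin_apply (Primrec.fst.comp (Primrec.snd.comp Primrec.snd)) i

theorem primrec_first (i : Fin 2) : Primrec fun x : TestInstance => x.2.2.2.1 i :=
  Primrec.fin_apply (Primrec.fst.comp (Primrec.snd.comp (Primrec.snd.comp Primrec.snd))) i

theorem primrec_second (i : Fin 2) : Primrec fun x : TestInstance => x.2.2.2.2 i :=
  Primrec.fin_apply (Primrec.snd.comp (Primrec.snd.comp (Primrec.snd.comp Primrec.snd))) i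

end TestInstance

open TestInstance

theorem primrecPred_pointsToCandidate : PrimrecPred PointsToCandidate := by
  have h4 := Primrec.nat_mul.comp primrec_pow_level primrec_pow_level
  have hP := Primrec.nat_mul.comp (Primrec.nat_add.comp (Primrec.nat_add.comp
    (Primrec.nat_mul.comp (primrec_first 0) (primrec_second 1))
    (Primrec.nat_mul.comp (primrec_first 1) (primrec_candidate 0)))
    (Primrec.nat_mul.comp (primrec_candidate 1) (primrec_second 0))) primrec_pow_precision
  have hN := Primrec.nat_mul.comp (Primrec.nat_add.comp (Primrec.nat_add.comp
    (Primrec.nat_mul.comp (primrec_first 0) (primrec_candidate 1))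
    (Primrec.nat_mul.comp (primrec_candidate 0) (primrec_second 1)))
    (Primrec.nat_mul.comp (primrec_first 1) (primrec_second 0))) primrec_pow_precision
  exact (Primrec.nat_le.comp hP (Primrec.nat_add.comp hN h4)).and
    (Primrec.nat_le.comp hN (Primrec.nat_add.comp hP h4))

theorem pointsToCandidate_iff (M m n : ℕ) (s p r : Fin 2 → ℕ) :
    PointsToCandidate (m, n, s, p, r) ↔
      |planeCross (gridPoint M n p - gridPoint M n s) (gridPoint M n r - gridPoint M n s)| ≤
        1 / 2 ^ m := by
  have hm : (0 : ℝ) < 2 ^ m := by positivity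
  have hn : (0 : ℝ) < 2 ^ n := by positivity
  have h : planeCross (gridPoint M n p - gridPoint M n s) (gridPoint M n r - gridPoint M n s) =
      (((p 0 : ℝ) * r 1 + p 1 * s 0 + s 1 * r 0) - (p 0 * s 1 + s 0 * r 1 + p 1 * r 0)) /
        (2 ^ n * 2 ^ n) := by
    simp only [planeCross, PiLp.sub_apply, gridPoint_apply]
    field_simp
    ring
  rw [h, abs_div, abs_of_pos (mul_pos hn hn), div_le_div_iff₀ (mul_pos hn hn) hm,
    ← abs_of_pos hm, ← abs_mul, abs_le, PointsToCandidate,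
    ← Nat.cast_le (α := ℝ), ← Nat.cast_le (α := ℝ)]
  push_cast
  constructor
  · rintro ⟨h1, h2⟩
    constructor <;> linarith
  · rintro ⟨h1, h2⟩
    constructor <;> linarith

theorem abs_planeCross_sub_le {u v u' v' : EuclideanSpace ℝ (Fin 2)} {L δ : ℝ}
    (hu : ∀ i, |u i| ≤ L) (hv : ∀ i, |v' i| ≤ L) (huu : ∀ i, |u i - u' i| ≤ δ)
    (hvv : ∀ i, |v i - v' i| ≤ δ) : |planeCross u v - planeCross u' v'| ≤ 4 * (L * δ) := by
  have key : ∀ {a b L δ : ℝ}, |a| ≤ L → |b| ≤ δ → |a * b| ≤ L * δ := fun ha hb => by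
    rw [abs_mul]
    exact mul_le_mul ha hb (abs_nonneg _) ((abs_nonneg _).trans ha)
  have h1 := abs_le.1 (key (hu 0) (hvv 1))
  have h2 := abs_le.1 (key (hv 1) (huu 0))
  have h3 := abs_le.1 (key (hu 1) (hvv 0))
  have h4 := abs_le.1 (key (hv 0) (huu 1))
  rw [abs_le]
  unfold planeCross
  constructor <;> linarith

/-- Cramer's rule, quantitatively: a vector almost parallel to two independent vectors is small. -/
theorem abs_mul_le_of_planeCross_le {α β w : EuclideanSpace ℝ (Fin 2)} {L e : ℝ}
    (hα : ∀ i, |α i| ≤ L) (hβ : ∀ i, |β i| ≤ L) (h1 : |planeCross α w| ≤ e)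
    (h2 : |planeCross β w| ≤ e) (i : Fin 2) : |w i * planeCross α β| ≤ 2 * (L * e) := by
  have key : ∀ {a b : ℝ}, |a| ≤ L → |b| ≤ e → |a * b| ≤ L * e := fun ha hb => by
    rw [abs_mul]
    exact mul_le_mul ha hb (abs_nonneg _) ((abs_nonneg _).trans ha)
  have h3 := abs_le.1 (key (hβ i) h1)
  have h4 := abs_le.1 (key (hα i) h2)
  have h5 : w i * planeCross α β = β i * planeCross α w - α i * planeCross β w := by
    fin_cases i <;> simp [planeCross] <;> ring
  rw [h5, abs_le]
  constructor <;> linarith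

theorem isComputablePoint_of_not_collinear {A : Set (EuclideanSpace ℝ (Fin 2))}
    (hA : IsCoREClosed A) {z : EuclideanSpace ℝ (Fin 2)} (hz : z ∈ A)
    (hstar : ∀ a ∈ A, segment ℝ z a ⊆ A)
    (hseg : ∀ p r, segment ℝ p r ⊆ A → planeCross (p - z) (r - z) = 0)
    {a b : EuclideanSpace ℝ (Fin 2)} (ha : a ∈ A) (hb : b ∈ A)
    (hab : planeCross (a - z) (b - z) ≠ 0) : IsComputablePoint z := by
  obtain ⟨M, hM⟩ := exists_nat_abs_le z a b
  have hzM := fun i => (hM i).1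
  have haM := fun i => (hM i).2.1
  have hbM := fun i => (hM i).2.2
  have hsub : ∀ {x y : EuclideanSpace ℝ (Fin 2)}, (∀ i, |x i| ≤ M) → (∀ i, |y i| ≤ M) →
      ∀ i, |(x - y) i| ≤ 2 * (M : ℝ) := fun hx hy i => by
    rw [PiLp.sub_apply]
    exact (abs_sub _ _).trans (by linarith [hx i, hy i])
  refine isComputablePoint_of_search hA.2 M primrecPred_pointsToCandidate
    (2 * (2 * (2 * M * (1 + 8 * M)) / |planeCross (a - z) (b - z)|)) ?_ ?_
  · intro m
    by_contra! hcon
    -- The candidates are roundings of `z`. If each failed on some pair, the limit segment would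
    -- have a cross product bounded away from zero, against `hseg`.
    choose σ hσ hσz using fun k => exists_gridPoint_near hzM (m + k)
    choose p r hp hr hnear hbad using fun k =>
      hcon (m + k) (Nat.le_add_right _ _) (σ k) (hσ k)
    obtain ⟨x, y, φ, hφ, hxy, hx, hy⟩ := exists_limit_of_nearSegment hA.1 ⟨z, hz⟩ hp hr hnear
    have hlim : Tendsto (fun k => gridPoint M (m + φ k) (σ (φ k))) atTop (𝓝 z) := by
      rw [tendsto_iff_norm_sub_tendsto_zero]
      refine squeeze_zero (fun _ => norm_nonneg _) (fun k => ?_)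
        (tendsto_one_div_two_pow_add m hφ 2)
      rw [norm_sub_rev]
      exact (EuclideanSpace.norm_le_two_mul (hσz (φ k))).trans_eq (by ring)
    have hc := ((continuous_planeCross.tendsto (x - z, y - z)).comp
      ((hx.sub hlim).prodMk_nhds (hy.sub hlim))).abs
    rw [hseg x y hxy, abs_zero] at hc
    refine absurd (ge_of_tendsto hc (Eventually.of_forall fun k => ?_))
      (not_le.2 (by positivity : (0 : ℝ) < 1 / 2 ^ m))
    exact (not_le.1 fun h => hbad (φ k) ((pointsToCandidate_iff M _ _ _ _ _).2 h)).le
  · intro m n hmn s hs hall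
    have hsM := abs_gridPoint_le hs
    obtain ⟨ζ, hζ, hζz⟩ := exists_gridPoint_near hzM n
    have hζM := abs_gridPoint_le hζ
    have hmn' : (1 : ℝ) / 2 ^ n ≤ 1 / 2 ^ m :=
      one_div_le_one_div_of_le (by positivity) (pow_le_pow_right₀ one_le_two hmn)
    -- The test on the rounded segment from `x` to `z` contributes `1`, the rounding `4 * (2 * M)`.
    have key : ∀ x ∈ A, (∀ i, |x i| ≤ M) →
        |planeCross (x - z) (z - gridPoint M n s)| ≤ (1 + 8 * M) * (1 / 2 ^ m) := by
      intro x hx hxM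
      obtain ⟨ξ, hξ, hξx⟩ := exists_gridPoint_near hxM n
      have hseg' : segment ℝ x z ⊆ A := segment_symm ℝ z x ▸ hstar x hx
      have h1 := (pointsToCandidate_iff M _ _ _ _ _).1
        (hall ξ ζ hξ hζ (nearSegment_of_segment_subset hseg' hξx hζz))
      have h2 := abs_planeCross_sub_le (hsub hxM hsM) (hsub hζM hsM)
        (u' := gridPoint M n ξ - gridPoint M n s) (v := z - gridPoint M n s) (δ := 1 / 2 ^ n)
        (fun i => by simpa using hξx i) (fun i => by simpa using hζz i)
      have h3 : planeCross (x - z) (z - gridPoint M n s) =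
          planeCross (x - gridPoint M n s) (z - gridPoint M n s) := by
        simp only [planeCross, PiLp.sub_apply]
        ring
      have h4 : 4 * (2 * (M : ℝ) * (1 / 2 ^ n)) ≤ 4 * (2 * (M : ℝ) * (1 / 2 ^ m)) := by gcongr
      rw [h3]
      have h5 := abs_le.1 h1
      have h6 := abs_le.1 (h2.trans h4)
      rw [abs_le]
      constructor <;> linarith
    have hD : 0 < |planeCross (a - z) (b - z)| := abs_pos.2 hab
    refine (EuclideanSpace.norm_le_two_mul
      (a := 2 * (2 * M * (1 + 8 * M)) / |planeCross (a - z) (b - z)| / 2 ^ m)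
      fun i => ?_).trans_eq (by ring)
    have h := abs_mul_le_of_planeCross_le (hsub haM hzM) (hsub hbM hzM) (key a ha haM)
      (key b hb hbM) i
    rw [abs_mul, ← le_div_iff₀ hD] at h
    exact h.trans_eq (by ring)

/-! ### Isolated intersections with rational lines -/

/-- If the grid point `p` is almost on the line `u 0 * x 0 + u 1 * x 1 = w` (in grid coordinates),
then it is almost equal to the candidate. -/
def NearLineImpliesNearCandidate (u : Fin 2 → ℕ) (w : ℕ) (x : TestInstance) : Prop :=
  u 0 * x.2.2.2.1 0 + u 1 * x.2.2.2.1 1 ≤ w * 2 ^ x.2.1 + (u 0 + u 1) →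
    w * 2 ^ x.2.1 ≤ u 0 * x.2.2.2.1 0 + u 1 * x.2.2.2.1 1 + (u 0 + u 1) →
      ∀ i, x.2.2.2.1 i * 2 ^ x.1 ≤ x.2.2.1 i * 2 ^ x.1 + 2 ^ x.2.1 ∧
        x.2.2.1 i * 2 ^ x.1 ≤ x.2.2.2.1 i * 2 ^ x.1 + 2 ^ x.2.1

theorem primrecPred_nearLineImpliesNearCandidate (u : Fin 2 → ℕ) (w : ℕ) :
    PrimrecPred (NearLineImpliesNearCandidate u w) := by
  have hu : Primrec fun x : TestInstance => u 0 * x.2.2.2.1 0 + u 1 * x.2.2.2.1 1 :=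
    Primrec.nat_add.comp (Primrec.nat_mul.comp (Primrec.const (u 0)) (primrec_first 0))
      (Primrec.nat_mul.comp (Primrec.const (u 1)) (primrec_first 1))
  have hw : Primrec fun x : TestInstance => w * 2 ^ x.2.1 :=
    Primrec.nat_mul.comp (Primrec.const w) primrec_pow_level
  have hc : Primrec fun _ : TestInstance => u 0 + u 1 := Primrec.const _
  have h1 : PrimrecPred fun x : TestInstance =>
      u 0 * x.2.2.2.1 0 + u 1 * x.2.2.2.1 1 ≤ w * 2 ^ x.2.1 + (u 0 + u 1) :=
    Primrec.nat_le.comp hu (Primrec.nat_add.comp hw hc)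
  have h2 : PrimrecPred fun x : TestInstance =>
      w * 2 ^ x.2.1 ≤ u 0 * x.2.2.2.1 0 + u 1 * x.2.2.2.1 1 + (u 0 + u 1) :=
    Primrec.nat_le.comp hw (Primrec.nat_add.comp hu hc)
  have hi : ∀ i, PrimrecPred fun x : TestInstance =>
      x.2.2.2.1 i * 2 ^ x.1 ≤ x.2.2.1 i * 2 ^ x.1 + 2 ^ x.2.1 ∧
        x.2.2.1 i * 2 ^ x.1 ≤ x.2.2.2.1 i * 2 ^ x.1 + 2 ^ x.2.1 := by
    intro i
    have hp : Primrec fun x : TestInstance => x.2.2.2.1 i * 2 ^ x.1 :=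
      Primrec.nat_mul.comp (primrec_first i) primrec_pow_precision
    have hs : Primrec fun x : TestInstance => x.2.2.1 i * 2 ^ x.1 :=
      Primrec.nat_mul.comp (primrec_candidate i) primrec_pow_precision
    exact (Primrec.nat_le.comp hp (Primrec.nat_add.comp hs primrec_pow_level)).and
      (Primrec.nat_le.comp hs (Primrec.nat_add.comp hp primrec_pow_level))
  have h3 := h1.not.or (h2.not.or ((hi 0).and (hi 1)))
  refine h3.of_eq fun x => ?_
  rw [NearLineImpliesNearCandidate, Fin.forall_fin_two, ← imp_iff_not_or, ← imp_iff_not_or]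

theorem nearLineImpliesNearCandidate_iff (u : Fin 2 → ℕ) (w M m n : ℕ) (s p r : Fin 2 → ℕ) :
    NearLineImpliesNearCandidate u w (m, n, s, p, r) ↔
      (|u 0 * (gridPoint M n p 0 + M) + u 1 * (gridPoint M n p 1 + M) - w| ≤
          ((u 0 : ℝ) + u 1) / 2 ^ n →
        ∀ i, |gridPoint M n p i - gridPoint M n s i| ≤ 1 / 2 ^ m) := by
  have hm : (0 : ℝ) < 2 ^ m := by positivity
  have hn : (0 : ℝ) < 2 ^ n := by positivity
  have h1 : (u 0 : ℝ) * (gridPoint M n p 0 + M) + u 1 * (gridPoint M n p 1 + M) - w =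
      ((u 0 : ℝ) * p 0 + u 1 * p 1 - w * 2 ^ n) / 2 ^ n := by
    simp only [gridPoint_apply]
    field_simp
    ring
  have h2 : ∀ i, gridPoint M n p i - gridPoint M n s i = ((p i : ℝ) - s i) / 2 ^ n := by
    intro i
    simp only [gridPoint_apply]
    ring
  rw [h1, abs_div, abs_of_pos hn, div_le_div_iff_of_pos_right hn, abs_le]
  simp only [NearLineImpliesNearCandidate]
  simp only [h2, abs_div, abs_of_pos hn, div_le_div_iff₀ hn hm]
  rw [and_imp]
  simp only [← Nat.cast_le (α := ℝ)]
  push_cast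
  have h3 : ∀ i, |(p i : ℝ) - s i| * 2 ^ m ≤ 1 * 2 ^ n ↔
      (p i : ℝ) * 2 ^ m ≤ s i * 2 ^ m + 2 ^ n ∧ (s i : ℝ) * 2 ^ m ≤ p i * 2 ^ m + 2 ^ n := by
    intro i
    rw [← abs_of_pos hm, ← abs_mul, abs_of_pos hm, abs_le]
    constructor
    · rintro ⟨h4, h5⟩
      constructor <;> linarith
    · rintro ⟨h4, h5⟩
      constructor <;> linarith
  simp only [h3]
  constructor
  · exact fun h h4 h5 => h (by linarith) (by linarith)
  · exact fun h h4 h5 => h (by linarith) (by linarith)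

/-- Only the first point of each pair matters. Limits of surviving points near the line lie in `A`
and on the line, hence equal `z`; conversely the rounding of `z` survives and pins the candidate
down. Shifting by `M` lets the test use natural numbers. -/
theorem isComputablePoint_of_unique_on_line {A : Set (EuclideanSpace ℝ (Fin 2))}
    (hA : IsCoREClosed A) {z : EuclideanSpace ℝ (Fin 2)} (hz : z ∈ A) {M : ℕ}
    (hM : ∀ i, |z i| ≤ M) (u : Fin 2 → ℕ) (w : ℕ)
    (hzw : u 0 * (z 0 + M) + u 1 * (z 1 + M) = w)
    (huniq : ∀ x ∈ A, u 0 * (x 0 + M) + u 1 * (x 1 + M) = w → x = z) :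
    IsComputablePoint z := by
  refine isComputablePoint_of_search hA.2 M (primrecPred_nearLineImpliesNearCandidate u w)
    (2 * 2) ?_ ?_
  · intro m
    by_contra! hcon
    choose σ hσ hσz using fun k => exists_gridPoint_near hM (m + k)
    choose p r hp hr hnear hbad using fun k =>
      hcon (m + k) (Nat.le_add_right _ _) (σ k) (hσ k)
    obtain ⟨x, y, φ, hφ, hxy, hx, -⟩ := exists_limit_of_nearSegment hA.1 ⟨z, hz⟩ hp hr hnear
    have hcoord : ∀ i, Tendsto (fun k => gridPoint M (m + φ k) (p (φ k)) i) atTop (𝓝 (x i)) :=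
      fun i => ((continuous_apply i).comp (PiLp.continuous_ofLp 2 _)).continuousAt.tendsto.comp hx
    have hlim : ∀ i, Tendsto (fun k => gridPoint M (m + φ k) (σ (φ k)) i) atTop (𝓝 (z i)) := by
      intro i
      rw [tendsto_iff_norm_sub_tendsto_zero]
      refine squeeze_zero (fun _ => norm_nonneg _) (fun k => ?_)
        (tendsto_one_div_two_pow_add m hφ 1)
      rw [norm_sub_rev]
      exact hσz (φ k) i
    simp only [nearLineImpliesNearCandidate_iff u w M, Classical.not_imp] at hbad
    have hxz : x = z := by
      refine huniq x (hxy (left_mem_segment ℝ x y)) ?_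
      have h1 := (((((hcoord 0).add_const (M : ℝ)).const_mul (u 0 : ℝ)).add
        (((hcoord 1).add_const (M : ℝ)).const_mul (u 1 : ℝ))).sub_const (w : ℝ)).abs
      have h2 := le_of_tendsto_of_tendsto h1 (tendsto_one_div_two_pow_add m hφ _)
        (Eventually.of_forall fun k => (hbad (φ k)).1)
      exact sub_eq_zero.1 (abs_nonpos_iff.1 h2)
    subst hxz
    have h0 : ∀ i, ∀ᶠ k in atTop,
        |gridPoint M (m + φ k) (p (φ k)) i - gridPoint M (m + φ k) (σ (φ k)) i| < 1 / 2 ^ m := by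
      intro i
      have h := ((hcoord i).sub (hlim i)).abs
      rw [sub_self, abs_zero] at h
      exact h.eventually_lt_const (by positivity)
    obtain ⟨k, hk⟩ := (eventually_all.2 h0).exists
    exact (hbad (φ k)).2 fun i => (hk i).le
  · intro m n hmn s hs hall
    obtain ⟨ζ, hζ, hζz⟩ := exists_gridPoint_near hM n
    have hmn' : (1 : ℝ) / 2 ^ n ≤ 1 / 2 ^ m :=
      one_div_le_one_div_of_le (by positivity) (pow_le_pow_right₀ one_le_two hmn)
    have hseg : segment ℝ z z ⊆ A := by simpa using hz
    have h1 := (nearLineImpliesNearCandidate_iff u w M _ _ _ _ _).1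
      (hall ζ ζ hζ hζ (nearSegment_of_segment_subset hseg hζz hζz)) (by
        have h2 := abs_le.1 (hζz 0)
        have h3 := abs_le.1 (hζz 1)
        have hu0 : (0 : ℝ) ≤ u 0 := Nat.cast_nonneg _
        have hu1 : (0 : ℝ) ≤ u 1 := Nat.cast_nonneg _
        rw [← hzw, add_div, abs_le]
        have e0 := mul_le_mul_of_nonneg_left h2.1 hu0
        have e1 := mul_le_mul_of_nonneg_left h2.2 hu0
        have e2 := mul_le_mul_of_nonneg_left h3.1 hu1
        have e3 := mul_le_mul_of_nonneg_left h3.2 hu1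
        constructor <;> ring_nf at * <;> linarith)
    refine (EuclideanSpace.norm_le_two_mul (a := 2 / 2 ^ m) fun i => ?_).trans_eq (by ring)
    have h2 := abs_le.1 (h1 i)
    have h3 := abs_le.1 ((hζz i).trans hmn')
    rw [PiLp.sub_apply, abs_le]
    have h4 : (2 : ℝ) / 2 ^ m = 1 / 2 ^ m + 1 / 2 ^ m := by ring
    constructor <;> linarith

theorem exists_isComputablePoint_of_collinear {A : Set (EuclideanSpace ℝ (Fin 2))}
    (hA : IsCoREClosed A) {s : EuclideanSpace ℝ (Fin 2)} (hs : s ∈ A)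
    (hstar : ∀ a ∈ A, segment ℝ s a ⊆ A)
    (hline : ∀ a ∈ A, ∀ b ∈ A, planeCross (a - s) (b - s) = 0) :
    ∃ x ∈ A, IsComputablePoint x := by
  by_cases hsing : ∀ a ∈ A, a = s
  · obtain ⟨M, hM⟩ := exists_nat_abs_le s s s
    -- With zero coefficients the "line" is the whole plane.
    exact ⟨s, hs, isComputablePoint_of_unique_on_line hA hs (fun i => (hM i).1) (fun _ => 0) 0
      (by simp) fun x hx _ => hsing x hx⟩
  push Not at hsing
  obtain ⟨a, ha, has⟩ := hsing
  obtain ⟨i, hi⟩ : ∃ i, a i ≠ s i := by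
    by_contra! h
    exact has (PiLp.ext h)
  obtain ⟨q, hq⟩ : ∃ q : ℚ, ∃ t ∈ Set.Ioo (0 : ℝ) 1, (q : ℝ) = s i + t * (a i - s i) := by
    rcases lt_or_gt_of_ne hi with h | h
    · obtain ⟨q, h1, h2⟩ := exists_rat_btwn h
      refine ⟨q, (s i - q) / (s i - a i), ⟨div_pos (by linarith) (by linarith), ?_⟩, ?_⟩
      · rw [div_lt_one (by linarith)]
        linarith
      · have : s i - a i ≠ 0 := by linarith
        field_simp
        ring
    · obtain ⟨q, h1, h2⟩ := exists_rat_btwn h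
      refine ⟨q, (q - s i) / (a i - s i), ⟨div_pos (by linarith) (by linarith), ?_⟩, ?_⟩
      · rw [div_lt_one (by linarith)]
        linarith
      · have : a i - s i ≠ 0 := by linarith
        field_simp
        ring
  obtain ⟨t, ⟨ht0, ht1⟩, hqt⟩ := hq
  set z := s + t • (a - s) with hzdef
  have hz : z ∈ A := hstar a ha ⟨1 - t, t, by linarith, ht0.le, by ring, by
    rw [hzdef, smul_sub, sub_smul, one_smul]; abel⟩
  have hzi : z i = q := by simp [hzdef, hqt]
  have huniq : ∀ x ∈ A, x i = q → x = z := by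
    intro x hx hxq
    have hc := hline a ha x hx
    have hai : a i - s i ≠ 0 := sub_ne_zero.2 hi
    have hxi : x i - s i = t * (a i - s i) := by linarith
    ext j
    refine mul_left_cancel₀ hai ?_
    have hc' : (a i - s i) * (x j - s j) = (a j - s j) * (x i - s i) := by
      simp only [planeCross, PiLp.sub_apply] at hc
      fin_cases i <;> fin_cases j <;> simp at hc ⊢ <;> linarith
    simp only [hzdef, PiLp.add_apply, PiLp.smul_apply, PiLp.sub_apply, smul_eq_mul]
    rw [hxi] at hc'
    linarith
  obtain ⟨M, hM⟩ := exists_nat_abs_le z z z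
  have hden : (0 : ℝ) < q.den := by exact_mod_cast q.pos
  have hqM : (0 : ℝ) ≤ q + M := by
    have := (abs_le.1 (hM i).1).1
    linarith
  -- Clearing denominators in `x i + M = q + M` gives the natural coefficients; `|z i| ≤ M` keeps
  -- the right side nonnegative.
  have hnum : (0 : ℤ) ≤ q.num + M * q.den := by
    have h : (q : ℝ) * q.den = q.num := by exact_mod_cast Rat.mul_den_eq_num q
    have h2 : (0 : ℝ) ≤ (q.num : ℝ) + M * q.den := by
      rw [← h, ← add_mul]
      exact mul_nonneg hqM hden.le
    exact_mod_cast h2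
  have hw : (((q.num + M * q.den).toNat : ℕ) : ℝ) = q.den * (q + M) := by
    have h1 : (((q.num + M * q.den).toNat : ℤ) : ℝ) = ((q.num + M * q.den : ℤ) : ℝ) := by
      rw [Int.toNat_of_nonneg hnum]
    have h : (q : ℝ) * q.den = q.num := by exact_mod_cast Rat.mul_den_eq_num q
    push_cast at h1
    rw [h1, ← h]
    ring
  have hsum : ∀ x : EuclideanSpace ℝ (Fin 2),
      ((if (0 : Fin 2) = i then q.den else 0 : ℕ) : ℝ) * (x 0 + M) +
        ((if (1 : Fin 2) = i then q.den else 0 : ℕ) : ℝ) * (x 1 + M) = q.den * (x i + M) := by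
    intro x
    fin_cases i <;> simp
  refine ⟨z, hz, isComputablePoint_of_unique_on_line hA hz (fun i => (hM i).1)
    (fun j => if j = i then q.den else 0) (q.num + M * q.den).toNat ?_ fun x hx h => ?_⟩
  · rw [hsum, hzi, hw]
  · rw [hsum, hw] at h
    exact huniq x hx (by linarith [mul_left_cancel₀ hden.ne' h])

/-! ### Rational points and the final case distinction -/

theorem isComputablePoint_ratPoint {d : ℕ} (c : Fin d → RatCode) :
    IsComputablePoint (ratPoint c) :=
  ⟨fun _ => c, Computable.const c, fun n => by simp⟩

theorem theoremt (A : Set (EuclideanSpace ℝ (Fin 2))) (hne : A.Nonempty)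
    (hA : IsCoREClosed A) (hstar : IsStarShaped A) :
    ∃ x ∈ A, IsComputablePoint x := by
  obtain ⟨s, hs, hseg⟩ := hstar
  by_cases hrat : ∃ c, ratPoint c ∈ A
  · obtain ⟨c, hc⟩ := hrat
    exact ⟨_, hc, isComputablePoint_ratPoint c⟩
  push Not at hrat
  by_cases hline : ∀ a ∈ A, ∀ b ∈ A, planeCross (a - s) (b - s) = 0
  · exact exists_isComputablePoint_of_collinear hA hs hseg hline
  push Not at hline
  obtain ⟨a, ha, b, hb, hab⟩ := hline
  exact ⟨s, hs, isComputablePoint_of_not_collinear hA hs hseg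
    (fun _ _ h => planeCross_eq_zero_of_segment_subset hseg hrat h) ha hb hab⟩
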